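/- Let $\mathfrak g$ be a finite-dimensional simple Lie algebra over $\mathbb C$, let $\mathfrak h\subset\mathfrak g$ be a Cartan subalgebra, and fix a base (set of simple roots) of the root system of $(\mathfrak g,\mathfrak h)$. Let $Q\subset\mathfrak h^*$ be the root lattice (the $\mathbb Z$-span of the roots), and let $P_+\subset\mathfrak h^*$ be the set of dominant integral weights, i.e. those $\lambda\in\mathfrak h^*$ with $\lambda(\alpha^\vee)\in\mathbb Z_{\ge 0}$ for every simple coroot $\alpha^\vee$. For $\nu\in P_+$ let $L(\nu)$ be the irreducible $\mathfrak g$-module of highest weight $\nu$ (the irreducible quotient of the Verma module of highest weight $\nu$), and for $\mu\in\mathfrak h^*$ let $m_\nu(\mu)=\dim\{v\in L(\nu): hv=\mu(h)v\ \text{for all}\ h\in\mathfrak h\}$ be the multiplicity of the weight $\mu$ in $L(\nu)$. Let $\lambda\in P_+\setminus\{0\}$ and $\mu\in\lambda+Q$. Then there is an integer $N\ge 0$ such that for all integers $n\ge N$ with $n\lambda\in\lambda+Q$ one has $m_{n\lambda}(\mu)\neq 0$. -/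

import Mathlib

noncomputable section

namespace HighestWeight

open LieAlgebra LieAlgebra.IsKilling Module

variable {L : Type*} [LieRing L] [LieAlgebra ℂ L] [FiniteDimensional ℂ L] [IsKilling ℂ L]
  {H : LieSubalgebra ℂ L} [H.IsCartanSubalgebra]

/-- The root lattice `Q`: the `ℤ`-span of the roots in `H*`. -/
def rootLattice (H : LieSubalgebra ℂ L) [H.IsCartanSubalgebra] : AddSubgroup (Dual ℂ H) :=
  AddSubgroup.closure (Set.range (rootSystem H).root)

/-- `lam` is a dominant integral weight with respect to the base `b`: its value on each simple
coroot is a nonnegative integer. -/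
def IsDominantIntegral (b : (rootSystem H).Base) (lam : Dual ℂ H) : Prop :=
  ∀ i ∈ b.support, ∃ k : ℕ, lam ((rootSystem H).coroot i) = k

/-- The left ideal of `U(L)` generated by the positive root vectors and by the elements
`h - nu(h)` for `h` in the Cartan subalgebra. -/
def vermaIdeal (b : (rootSystem H).Base) (nu : Dual ℂ H) :
    Submodule (UniversalEnvelopingAlgebra ℂ L) (UniversalEnvelopingAlgebra ℂ L) :=
  Submodule.span (UniversalEnvelopingAlgebra ℂ L)
    ({u | ∃ i : H.root, b.IsPos i ∧ ∃ x ∈ rootSpace H (i : LieModule.Weight ℂ H L),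
        u = UniversalEnvelopingAlgebra.ι ℂ x} ∪
      {u | ∃ h : H, u = UniversalEnvelopingAlgebra.ι ℂ (h : L) -
        algebraMap ℂ (UniversalEnvelopingAlgebra ℂ L) (nu h)})

/-- The Verma module of highest weight `nu`. -/
abbrev Verma (b : (rootSystem H).Base) (nu : Dual ℂ H) : Type _ :=
  UniversalEnvelopingAlgebra ℂ L ⧸ vermaIdeal b nu

/-- The sum of all proper submodules of the Verma module, i.e. its largest proper submodule. -/
def vermaRadical (b : (rootSystem H).Base) (nu : Dual ℂ H) :
    Submodule (UniversalEnvelopingAlgebra ℂ L) (Verma b nu) :=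
  sSup {N | N ≠ ⊤}

/-- The irreducible highest weight module `L(nu)`: the irreducible quotient of the Verma module
of highest weight `nu`. -/
abbrev Irr (b : (rootSystem H).Base) (nu : Dual ℂ H) : Type _ :=
  Verma b nu ⧸ vermaRadical b nu

/-- The Lie algebra `L` acts on `L(nu)` through the universal enveloping algebra. -/
instance instLieRingModuleIrr (b : (rootSystem H).Base) (nu : Dual ℂ H) :
    LieRingModule L (Irr b nu) where
  bracket x m := UniversalEnvelopingAlgebra.ι ℂ x • m
  add_lie x y m := by
    rw [map_add, add_smul]
  lie_add x m n := smul_add _ m n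
  leibniz_lie x y m := by
    let _ : LieRing (UniversalEnvelopingAlgebra ℂ L) := LieRing.ofAssociativeRing
    change _ • _ • m = UniversalEnvelopingAlgebra.ι ℂ ⁅x, y⁆ • m + _ • _ • m
    rw [LieHom.map_lie, LieRing.of_associative_ring_bracket, sub_smul, mul_smul, mul_smul,
      sub_add_cancel]

instance instLieModuleIrr (b : (rootSystem H).Base) (nu : Dual ℂ H) :
    LieModule ℂ L (Irr b nu) where
  smul_lie c x m := by
    change UniversalEnvelopingAlgebra.ι ℂ (c • x) • m = c • (UniversalEnvelopingAlgebra.ι ℂ x • m)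
    rw [map_smul, smul_assoc]
  lie_smul c x m := by
    change UniversalEnvelopingAlgebra.ι ℂ x • c • m = c • (UniversalEnvelopingAlgebra.ι ℂ x • m)
    rw [smul_comm]

/-- The multiplicity `m_nu(mu)`: the dimension of the `mu`-weight space
`{v | ∀ h ∈ H, h v = mu(h) v}` of `L(nu)`. -/
def multiplicity (b : (rootSystem H).Base) (nu mu : Dual ℂ H) : ℕ :=
  finrank ℂ (LieModule.weightSpace (R := ℂ) (L := H) (Irr b nu) (fun h => mu h))

end HighestWeight

end

/-! If `mu` is dominant, then for large `n` the difference `n • lam - mu` is a nonnegative integral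
combination of simple roots: a nonzero dominant weight of an irreducible root system has strictly
positive coordinates in the simple roots (`RootPairing.Base.re_repr_pos`), and membership in the
root lattice makes the coordinates integers. A dominant weight lying below a weight of `L(nu)` in
this sense is again a weight (`multiplicity_ne_zero_of_le`): one descends from `nu` a simple root at
a time, positive definiteness of the invariant form always supplying a simple root that can be
subtracted.

If `mu` is not dominant, a simple reflection raises it and lowers the number of positive roots on
whose coroots it is negative. The root string through the reflected weight leads back to `mu`, so
induction on that number reduces to the dominant case.

Both steps rest on `multiplicity_sub_nsmul_ne_zero`, an `sl₂` argument that needs only local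
nilpotency of raising operators, not finite-dimensionality of `L(nu)`. The facts used about `L(nu)`
are that it is generated by a nonzero vector of weight `nu` killed by positive root vectors, and
that its weight spaces are finite-dimensional. That the generator is nonzero (`irrGen_ne_zero`) is
proved without the PBW theorem, by letting `L` act on the enveloping algebra of the negative part.
-/

/-! ### Modules induced from a character of a subalgebra with a complement -/

section InducedModule

attribute [local instance] LieRing.ofAssociativeRing

open UniversalEnvelopingAlgebra

variable {R L : Type*} [CommRing R] [LieRing L] [LieAlgebra R L]

/-- Induction principle for the enveloping algebra, by left multiplication with elements of `L`. -/
theorem UniversalEnvelopingAlgebra.induction_mul_left {p : UniversalEnvelopingAlgebra R L → Prop}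
    (one : p 1) (add : ∀ u v, p u → p v → p (u + v)) (smul : ∀ (r : R) u, p u → p (r • u))
    (mul : ∀ x u, p u → p (ι R x * u)) (u : UniversalEnvelopingAlgebra R L) : p u := by
  let S : Submodule R (UniversalEnvelopingAlgebra R L) :=
    { carrier := {w | p w}
      add_mem' := fun h h' ↦ add _ _ h h'
      zero_mem' := by simpa using smul 0 1 one
      smul_mem' := fun r w h ↦ smul r w h }
  let A : Subalgebra R (UniversalEnvelopingAlgebra R L) :=
    { carrier := {w | ∀ z ∈ S, w * z ∈ S}
      mul_mem' := fun {a b} ha hb z hz ↦ by rw [mul_assoc]; exact ha _ (hb z hz)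
      add_mem' := fun {a b} ha hb z hz ↦ by rw [add_mul]; exact S.add_mem (ha z hz) (hb z hz)
      algebraMap_mem' := fun r z hz ↦ by
        rw [← Algebra.smul_def]; exact S.smul_mem r hz }
  let f : L →ₗ⁅R⁆ A :=
    { toFun := fun x ↦ ⟨ι R x, fun z hz ↦ mul x z hz⟩
      map_add' := fun x y ↦ Subtype.ext (map_add _ _ _)
      map_smul' := fun r x ↦ Subtype.ext (map_smul _ _ _)
      map_lie' := fun {x y} ↦ Subtype.ext (LieHom.map_lie _ _ _) }
  have h : A.val.comp (lift R f) = AlgHom.id R _ := by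
    ext x
    simp [f]
  have hu : A.val (lift R f u) = u := DFunLike.congr_fun h u
  have := (lift R f u).2 1 one
  rw [mul_one] at this
  rw [← hu]
  exact this

variable (N : LieSubalgebra R L)

/-- The action of `N` on linear maps `L → U(N)` given by
`(n • φ) x = n * φ x - φ ⁅n, x⁆`. -/
def LieSubalgebra.homAction :
    N →ₗ⁅R⁆ Module.End R (L →ₗ[R] UniversalEnvelopingAlgebra R N) where
  toFun n :=
    { toFun := fun φ ↦ (LinearMap.mulLeft R (ι R n)).comp φ - φ.comp (LieAlgebra.ad R L (n : L))
      map_add' := fun φ ψ ↦ by ext; simp [-ι_apply, mul_add]; abel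
      map_smul' := fun r φ ↦ by ext; simp [-ι_apply, smul_sub] }
  map_add' m n := by ext; simp [-ι_apply, add_mul]; abel
  map_smul' r n := by ext; simp [-ι_apply, smul_sub]
  map_lie' {m n} := by
    ext φ x
    simp [-ι_apply, LieRing.of_associative_ring_bracket, sub_mul, mul_sub, mul_assoc]
    abel

/-- The linear action of `L` on `U(N)` extending a given value `φ₀ : L → U(N)` at `1` and
satisfying `x (n u) = n (x u) + ⁅x, n⁆ u`. -/
def LieSubalgebra.inducedAction (φ₀ : L →ₗ[R] UniversalEnvelopingAlgebra R N) :
    L →ₗ[R] Module.End R (UniversalEnvelopingAlgebra R N) :=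
  -- The recursion on `u` is posed for all `x` at once, as the orbit map of `φ₀` for an action of
  -- `U(N)` on `L →ₗ U(N)`. Well-definedness is then exactly the bracket relation proved in
  -- `homAction`.
  (LinearMap.applyₗ φ₀ ∘ₗ (lift R N.homAction).toLinearMap).flip

variable {N} (φ₀ : L →ₗ[R] UniversalEnvelopingAlgebra R N)

theorem LieSubalgebra.inducedAction_one (x : L) : N.inducedAction φ₀ x 1 = φ₀ x := by
  simp [inducedAction]

theorem LieSubalgebra.inducedAction_ι_mul (x : L) (n : N) (u : UniversalEnvelopingAlgebra R N) :
    N.inducedAction φ₀ x (ι R n * u) =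
      ι R n * N.inducedAction φ₀ x u + N.inducedAction φ₀ ⁅x, (n : L)⁆ u := by
  rw [← lie_skew x (n : L), map_neg, LinearMap.neg_apply, ← sub_eq_add_neg]
  simp [-ι_apply, -lie_skew, inducedAction, lift_ι_apply, homAction]

variable {φ₀}

theorem LieSubalgebra.inducedAction_coe (hN : ∀ n : N, φ₀ n = ι R n) (n : N)
    (u : UniversalEnvelopingAlgebra R N) : N.inducedAction φ₀ n u = ι R n * u := by
  induction u using UniversalEnvelopingAlgebra.induction_mul_left generalizing n with
  | one => rw [inducedAction_one, hN, mul_one]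
  | add u v hu hv => rw [map_add, hu, hv, mul_add]
  | smul r u hu => rw [map_smul, hu, mul_smul_comm]
  | mul m u hu =>
    rw [inducedAction_ι_mul, hu, ← LieSubalgebra.coe_bracket, hu, LieHom.map_lie,
      LieRing.of_associative_ring_bracket, sub_mul, mul_assoc, mul_assoc]
    abel

/-- Induction on `u`: the Jacobi identity carries the relation from `u` to `n * u`. At `1`, pairs
with an entry in `N` are covered by the defining recursion, and pairs in `B` act on `1` by commuting
scalars, while `χ` kills their bracket. -/
theorem LieSubalgebra.inducedAction_lie {B : LieSubalgebra R L}
    (hNB : N.toSubmodule ⊔ B.toSubmodule = ⊤) (hN : ∀ n : N, φ₀ n = ι R n) (χ : L →ₗ[R] R)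
    (hB : ∀ b ∈ B, φ₀ b = algebraMap R _ (χ b)) (hχ : ∀ x ∈ B, ∀ y ∈ B, χ ⁅x, y⁆ = 0)
    (x y : L) (u : UniversalEnvelopingAlgebra R N) :
    N.inducedAction φ₀ ⁅x, y⁆ u = N.inducedAction φ₀ x (N.inducedAction φ₀ y u) -
      N.inducedAction φ₀ y (N.inducedAction φ₀ x u) := by
  induction u using UniversalEnvelopingAlgebra.induction_mul_left generalizing x y with
  | one =>
    have key (n : N) (y : L) : N.inducedAction φ₀ ⁅(n : L), y⁆ 1 =
        N.inducedAction φ₀ n (N.inducedAction φ₀ y 1) -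
        N.inducedAction φ₀ y (N.inducedAction φ₀ n 1) := by
      rw [inducedAction_coe hN, inducedAction_coe hN, inducedAction_ι_mul, ← lie_skew y (n : L),
        map_neg, LinearMap.neg_apply]
      abel
    obtain ⟨n, hn, b, hb, rfl⟩ := Submodule.mem_sup.mp (hNB ▸ Submodule.mem_top : x ∈ _)
    obtain ⟨n', hn', b', hb', rfl⟩ := Submodule.mem_sup.mp (hNB ▸ Submodule.mem_top : y ∈ _)
    have h₁ := key ⟨n, hn⟩ (n' + b')
    have h₂ := key ⟨n', hn'⟩ b
    have h₃ : N.inducedAction φ₀ ⁅b, b'⁆ 1 = 0 := by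
      rw [inducedAction_one, hB _ (B.lie_mem hb hb'), hχ b hb b' hb', map_zero]
    have h₄ (b c : L) (hb : b ∈ B) (hc : c ∈ B) :
        N.inducedAction φ₀ b (N.inducedAction φ₀ c 1) = algebraMap R _ (χ b * χ c) := by
      rw [inducedAction_one, hB c hc, Algebra.algebraMap_eq_smul_one, map_smul, inducedAction_one,
        hB b hb, mul_comm, map_mul, Algebra.smul_def]
    rw [add_lie, lie_add b, ← lie_skew b n', map_add, map_add, map_neg, LinearMap.add_apply,
      LinearMap.add_apply, LinearMap.neg_apply, h₁, h₂, h₃]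
    simp only [map_add, LinearMap.add_apply, h₄ b b' hb hb', h₄ b' b hb' hb, mul_comm (χ b')]
    abel
  | add u v hu hv => simp only [map_add, hu, hv]; abel
  | smul r u hu => simp only [map_smul, hu, smul_sub]
  | mul n u hu =>
    have hJ : ⁅⁅x, y⁆, (n : L)⁆ = ⁅x, ⁅y, (n : L)⁆⁆ - ⁅y, ⁅x, (n : L)⁆⁆ := lie_lie x y _
    simp only [inducedAction_ι_mul, map_add, hJ, map_sub, LinearMap.sub_apply, hu, mul_sub]
    abel

variable (N) in
/-- A character of `B` extends to a proper left ideal of `U(L)`, when `B` has a complementary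
subalgebra. -/
theorem UniversalEnvelopingAlgebra.span_sub_character_ne_top [Nontrivial R] {B : LieSubalgebra R L}
    (hNB : IsCompl N.toSubmodule B.toSubmodule) (χ : L →ₗ[R] R)
    (hχ : ∀ x ∈ B, ∀ y ∈ B, χ ⁅x, y⁆ = 0) :
    Submodule.span (UniversalEnvelopingAlgebra R L)
      {u | ∃ b ∈ B, u = ι R b - algebraMap R _ (χ b)} ≠ ⊤ := by
  let φ₀ : L →ₗ[R] UniversalEnvelopingAlgebra R N := LinearMap.ofIsCompl hNB
    (ι R : N →ₗ⁅R⁆ UniversalEnvelopingAlgebra R N).toLinearMap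
    ((Algebra.linearMap R _ ∘ₗ χ) ∘ₗ B.toSubmodule.subtype)
  have hN (n : N) : φ₀ n = ι R n := LinearMap.ofIsCompl_apply_left hNB n
  have hB (b) (hb : b ∈ B) : φ₀ b = algebraMap R _ (χ b) :=
    LinearMap.ofIsCompl_apply_right hNB ⟨b, hb⟩
  let ρ : L →ₗ⁅R⁆ Module.End R (UniversalEnvelopingAlgebra R N) :=
    { N.inducedAction φ₀ with
      map_lie' := fun {x y} ↦ LinearMap.ext fun u ↦
        LieSubalgebra.inducedAction_lie hNB.sup_eq_top hN χ hB hχ x y u }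
  intro htop
  have hann (w) (hw : w ∈ Submodule.span (UniversalEnvelopingAlgebra R L)
      {u | ∃ b ∈ B, u = ι R b - algebraMap R _ (χ b)}) : lift R ρ w 1 = 0 := by
    induction hw using Submodule.span_induction with
    | mem w hw =>
      obtain ⟨b, hb, rfl⟩ := hw
      rw [map_sub, lift_ι_apply, AlgHom.commutes, LinearMap.sub_apply,
        Module.algebraMap_end_apply, ← Algebra.algebraMap_eq_smul_one, ← hB b hb,
        ← LieSubalgebra.inducedAction_one φ₀ b]
      exact sub_self _
    | zero => simp
    | add u v _ _ hu hv => simp [hu, hv]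
    | smul a u _ hu => simp [hu]
  have h1 : (1 : UniversalEnvelopingAlgebra R N) = 0 := by
    simpa using hann 1 (htop ▸ Submodule.mem_top)
  -- The augmentation `U(N) → R` shows that `U(N)` is not the zero ring.
  have := congr_arg (lift R (0 : N →ₗ⁅R⁆ R)) h1
  simp at this

end InducedModule

/-! ### Cyclic modules graded by a semisimple element -/

section CyclicModule

open LieModule Module

variable {K L M : Type*} [Field K] [LieRing L] [LieAlgebra K L]
  [AddCommGroup M] [Module K M] [LieRingModule L M] [LieModule K L M]

variable (K) in
/-- The eigenspace of `ad d` with integer eigenvalue `k`. -/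
def LieAlgebra.adPart (d : L) (k : ℤ) : Submodule K L := (LieAlgebra.ad K L d).eigenspace (k : K)

open LieAlgebra (adPart)

theorem LieAlgebra.mem_adPart {d x : L} {k : ℤ} : x ∈ adPart K d k ↔ ⁅d, x⁆ = (k : K) • x := by
  simp [adPart]

theorem LieAlgebra.lie_mem_adPart {d x y : L} {j k : ℤ} (hx : x ∈ adPart K d j)
    (hy : y ∈ adPart K d k) : ⁅x, y⁆ ∈ adPart K d (j + k) := by
  rw [mem_adPart] at *
  rw [leibniz_lie, hx, hy, smul_lie, lie_smul, ← add_smul, Int.cast_add]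

variable (K) in
theorem LieAlgebra.iSupIndep_adPart [CharZero K] (d : L) : iSupIndep (adPart K d) :=
  (Module.End.eigenspaces_iSupIndep (LieAlgebra.ad K L d)).comp Int.cast_injective

variable (K) in
/-- The span of the vectors obtained from `v` by applying elements of `L` of negative degrees
with total degree `-j`. -/
def LieModule.lowering (d : L) (v : M) : ℕ → Submodule K M
  | 0 => K ∙ v
  | j + 1 => ⨆ k : Fin (j + 1), Submodule.map₂ (toEnd K L M : L →ₗ[K] End K M)
      (adPart K d ((k : ℤ) - (j + 1))) (lowering d v k)
  decreasing_by exact k.2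

variable {d : L} {v : M} {c : K}

theorem LieModule.lie_mem_eigenspace {x : L} {m : M} {k : ℤ} {a : K} (hx : x ∈ adPart K d k)
    (hm : m ∈ (toEnd K L M d).eigenspace a) : ⁅x, m⁆ ∈ (toEnd K L M d).eigenspace (a + k) := by
  rw [LieAlgebra.mem_adPart] at hx
  rw [Module.End.mem_eigenspace_iff, toEnd_apply_apply] at *
  rw [leibniz_lie, hx, hm, smul_lie, lie_smul, ← add_smul, add_comm]

theorem LieModule.lowering_le_eigenspace (hc : ⁅d, v⁆ = c • v) (j : ℕ) :
    lowering K d v j ≤ (toEnd K L M d).eigenspace (c - j) := by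
  induction j using Nat.strong_induction_on with
  | _ j ih =>
    cases j with
    | zero => simp [lowering, hc]
    | succ j =>
      rw [lowering]
      refine iSup_le fun k ↦ Submodule.map₂_le.mpr fun x hx m hm ↦ ?_
      have := lie_mem_eigenspace hx (ih k k.2 hm)
      convert this using 2
      · push_cast
        ring
      · rfl

theorem LieModule.lowering_fg [FiniteDimensional K L] (d : L) (v : M) (j : ℕ) :
    (lowering K d v j).FG := by
  induction j using Nat.strong_induction_on with
  | _ j ih =>
    cases j with
    | zero => rw [lowering]; exact Submodule.fg_span_singleton v
    | succ j =>
      rw [lowering]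
      exact Submodule.fg_iSup _ fun k ↦ Submodule.FG.map₂ _ (IsNoetherian.noetherian _) (ih k k.2)

theorem LieModule.lie_mem_lowering {x m : _} {j k : ℕ} (hx : x ∈ adPart K d (-((k : ℤ) + 1)))
    (hm : m ∈ lowering K d v j) : ⁅x, m⁆ ∈ lowering K d v (j + k + 1) := by
  rw [lowering]
  refine Submodule.mem_iSup_of_mem ⟨j, by lia⟩ (Submodule.apply_mem_map₂ _ ?_ hm)
  convert hx using 2
  push_cast
  ring

theorem LieModule.lie_mem_iSup_lowering_of_neg {k : ℤ} (hk : k < 0) {x : L}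
    (hx : x ∈ adPart K d k) {m : M} (hm : m ∈ ⨆ j, lowering K d v j) :
    ⁅x, m⁆ ∈ ⨆ j, lowering K d v j := by
  obtain ⟨i, rfl⟩ : ∃ i : ℕ, k = -((i : ℤ) + 1) := ⟨(-k - 1).toNat, by lia⟩
  induction hm using Submodule.iSup_induction' with
  | mem j m hm => exact Submodule.mem_iSup_of_mem _ (lie_mem_lowering hx hm)
  | zero => simp
  | add m m' _ _ h h' => rw [lie_add]; exact add_mem h h'

/-- Induction on depth through `x y m = ⁅x, y⁆ m + y x m` with `y` of negative degree: on the right,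
`⁅x, y⁆` and `x` hit the shallower vector `m`, and applying `y` preserves the sum. At depth zero the
parts of nonnegative degree preserve the line through `v`. -/
theorem LieModule.lie_mem_iSup_lowering (hL : ⨆ k, adPart K d k = ⊤)
    (hv : ∀ k : ℤ, 0 ≤ k → ∀ x ∈ adPart K d k, ⁅x, v⁆ ∈ K ∙ v) (x : L) {m : M}
    (hm : m ∈ ⨆ j, lowering K d v j) : ⁅x, m⁆ ∈ ⨆ j, lowering K d v j := by
  have key (j : ℕ) : ∀ x : L, ∀ m ∈ lowering K d v j, ⁅x, m⁆ ∈ ⨆ j, lowering K d v j := by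
    induction j using Nat.strong_induction_on with
    | _ j ih =>
      intro x m hm
      cases j with
      | zero =>
        have hv₀ : v ∈ ⨆ j, lowering K d v j :=
          Submodule.mem_iSup_of_mem 0 (by rw [lowering]; exact Submodule.mem_span_singleton_self v)
        rw [lowering] at hm
        obtain ⟨a, rfl⟩ := Submodule.mem_span_singleton.mp hm
        rw [lie_smul]
        refine Submodule.smul_mem _ _ ?_
        have hx : x ∈ ⨆ k, adPart K d k := hL ▸ Submodule.mem_top
        induction hx using Submodule.iSup_induction' with
        | mem k x hx =>
          rcases lt_or_ge k 0 with hk | hk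
          · exact lie_mem_iSup_lowering_of_neg hk hx hv₀
          · exact (Submodule.span_singleton_le_iff_mem _ _).mpr hv₀ (hv k hk x hx)
        | zero => simp
        | add m m' _ _ h h' => rw [add_lie]; exact add_mem h h'
      | succ j =>
        rw [lowering] at hm
        induction hm using Submodule.iSup_induction' with
        | mem k m hm =>
          have hle : Submodule.map₂ (toEnd K L M : L →ₗ[K] End K M)
              (adPart K d ((k : ℤ) - (j + 1))) (lowering K d v k) ≤
              (⨆ j, lowering K d v j).comap (toEnd K L M x) := by
            rw [Submodule.map₂_le]
            intro y hy m hm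
            have h := add_mem (ih k k.2 ⁅x, y⁆ m hm)
              (lie_mem_iSup_lowering_of_neg (by have := k.2; omega) hy (ih k k.2 x m hm))
            rwa [← leibniz_lie] at h
          exact hle hm
        | zero => simp
        | add m m' _ _ h h' => rw [lie_add]; exact add_mem h h'
  induction hm using Submodule.iSup_induction' with
  | mem j m hm => exact key j x m hm
  | zero => simp
  | add m m' _ _ h h' => rw [lie_add]; exact add_mem h h'

theorem LieModule.iSup_lowering_eq_top (hL : ⨆ k, adPart K d k = ⊤)
    (hv : ∀ k : ℤ, 0 ≤ k → ∀ x ∈ adPart K d k, ⁅x, v⁆ ∈ K ∙ v)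
    (hgen : LieSubmodule.lieSpan K L {v} = ⊤) : ⨆ j, lowering K d v j = ⊤ := by
  let S : LieSubmodule K L M :=
    { (⨆ j, lowering K d v j : Submodule K M) with lie_mem := lie_mem_iSup_lowering hL hv _ }
  have hS : LieSubmodule.lieSpan K L {v} ≤ S := by
    rw [LieSubmodule.lieSpan_le, Set.singleton_subset_iff]
    exact Submodule.mem_iSup_of_mem 0 (by rw [lowering]; exact Submodule.mem_span_singleton_self v)
  rw [eq_top_iff]
  intro m _
  exact hS (hgen ▸ LieSubmodule.mem_top m)

/-- The lowering spaces sit inside independent eigenspaces and already span everything, which forces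
equality. Hence these eigenspaces are finite-dimensional when `L` is, and the top one is the line
through `v`. -/
theorem LieModule.lowering_eq_eigenspace [CharZero K] (hL : ⨆ k, adPart K d k = ⊤)
    (hv : ∀ k : ℤ, 0 ≤ k → ∀ x ∈ adPart K d k, ⁅x, v⁆ ∈ K ∙ v)
    (hgen : LieSubmodule.lieSpan K L {v} = ⊤) (hc : ⁅d, v⁆ = c • v) (j : ℕ) :
    lowering K d v j = (toEnd K L M d).eigenspace (c - j) := by
  have hind : iSupIndep fun j : ℕ ↦ (toEnd K L M d).eigenspace (c - j) :=
    (Module.End.eigenspaces_iSupIndep (toEnd K L M d)).comp fun i j h ↦ by simpa using h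
  exact congr_fun ((hind.le_iff_eq_of_iSup_eq_top (iSup_lowering_eq_top hL hv hgen)).mp
    fun j ↦ lowering_le_eigenspace hc j) j

theorem LieModule.eigenspace_eq_bot (hL : ⨆ k, adPart K d k = ⊤)
    (hv : ∀ k : ℤ, 0 ≤ k → ∀ x ∈ adPart K d k, ⁅x, v⁆ ∈ K ∙ v)
    (hgen : LieSubmodule.lieSpan K L {v} = ⊤) (hc : ⁅d, v⁆ = c • v) {a : K}
    (ha : ∀ j : ℕ, a ≠ c - j) : (toEnd K L M d).eigenspace a = ⊥ := by
  have h := (Module.End.eigenspaces_iSupIndep (toEnd K L M d)) a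
  suffices ⨆ b, ⨆ (_ : b ≠ a), (toEnd K L M d).eigenspace b = ⊤ by rwa [this, disjoint_top] at h
  rw [eq_top_iff, ← iSup_lowering_eq_top hL hv hgen]
  exact iSup_le fun j ↦ (lowering_le_eigenspace hc j).trans <|
    le_iSup₂_of_le (c - j : K) (ha j).symm le_rfl

theorem LieModule.iSup_eigenspace_eq_top (hL : ⨆ k, adPart K d k = ⊤)
    (hv : ∀ k : ℤ, 0 ≤ k → ∀ x ∈ adPart K d k, ⁅x, v⁆ ∈ K ∙ v)
    (hgen : LieSubmodule.lieSpan K L {v} = ⊤) (hc : ⁅d, v⁆ = c • v) :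
    ⨆ b, (toEnd K L M d).eigenspace b = ⊤ := by
  rw [eq_top_iff, ← iSup_lowering_eq_top hL hv hgen]
  exact iSup_le fun j ↦ (lowering_le_eigenspace hc j).trans (le_iSup _ _)

/-- Elements of positive degree act nilpotently on every eigenvector of `d`. -/
theorem LieModule.exists_pow_toEnd_eq_zero [CharZero K] (hL : ⨆ k, adPart K d k = ⊤)
    (hv : ∀ k : ℤ, 0 ≤ k → ∀ x ∈ adPart K d k, ⁅x, v⁆ ∈ K ∙ v)
    (hgen : LieSubmodule.lieSpan K L {v} = ⊤) (hc : ⁅d, v⁆ = c • v) {k : ℤ} (hk : 0 < k)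
    {x : L} (hx : x ∈ adPart K d k) {m : M} {a : K} (hm : m ∈ (toEnd K L M d).eigenspace a) :
    ∃ n : ℕ, (toEnd K L M x ^ n) m = 0 := by
  have hpow (n : ℕ) : (toEnd K L M x ^ n) m ∈ (toEnd K L M d).eigenspace (a + (n * k : ℤ)) := by
    induction n with
    | zero => simpa using hm
    | succ n ih =>
      rw [pow_succ', Module.End.mul_apply]
      convert lie_mem_eigenspace hx ih using 2
      · push_cast
        ring
      · rfl
  by_cases ha : ∃ j : ℕ, a = c - j
  · obtain ⟨j, rfl⟩ := ha
    -- Since `k ≥ 1`, applying `x` `j + 1` times moves the eigenvalue `c - j` past the highest one,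
    -- `c`.
    refine ⟨j + 1, (Submodule.mem_bot K).mp ?_⟩
    rw [← eigenspace_eq_bot hL hv hgen hc]
    · exact hpow (j + 1)
    · intro i h
      have h : ((i + (j + 1 : ℕ) * k - j : ℤ) : K) = 0 := by
        push_cast at h ⊢
        linear_combination h
      rw [Int.cast_eq_zero] at h
      push_cast at h
      nlinarith
  · push Not at ha
    exact ⟨0, (Submodule.mem_bot K).mp (eigenspace_eq_bot hL hv hgen hc ha ▸ hm)⟩

end CyclicModule

/-! ### Eigencomponents in invariant subspaces, and graded subalgebras -/

section Eigenspace

open Module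

variable {K V : Type*} [Field K] [AddCommGroup V] [Module K V]

/-- An invariant subspace contains the eigencomponents of its elements. -/
theorem Module.End.mem_of_add_mem_of_mem_eigenspace {f : End K V} {p : Submodule K V}
    (hp : ∀ x ∈ p, f x ∈ p) {c : K} {e w : V} (he : e ∈ f.eigenspace c)
    (hw : w ∈ ⨆ b, ⨆ (_ : b ≠ c), f.eigenspace b) (h : e + w ∈ p) : e ∈ p := by
  have hpoly (q : Polynomial K) (x : V) (hx : x ∈ p) : Polynomial.aeval f q x ∈ p := by
    induction q using Polynomial.induction_on' with
    | add q r hq hr => rw [map_add, LinearMap.add_apply]; exact add_mem hq hr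
    | monomial n a =>
      rw [Polynomial.aeval_monomial, Module.End.mul_apply, Module.algebraMap_end_apply]
      refine p.smul_mem _ ?_
      induction n with
      | zero => simpa using hx
      | succ n ih => rw [pow_succ', Module.End.mul_apply]; exact hp _ ih
  -- A product of factors `X - b` over the eigenvalues `b ≠ c` occurring in `w` kills `w` and
  -- multiplies `e` by a nonzero scalar.
  obtain ⟨q, hqc, hqw⟩ : ∃ q : Polynomial K, q.eval c ≠ 0 ∧ Polynomial.aeval f q w = 0 := by
    rw [iSup_subtype'] at hw
    clear h
    induction hw using Submodule.iSup_induction' with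
    | mem b w hw =>
      refine ⟨.X - .C b.1, by simpa [sub_eq_zero] using b.2.symm, ?_⟩
      simp [Module.End.mem_eigenspace_iff.mp hw]
    | zero => exact ⟨1, by simp, by simp⟩
    | add w w' _ _ h h' =>
      obtain ⟨q, hq, hqw⟩ := h
      obtain ⟨r, hr, hrw⟩ := h'
      refine ⟨q * r, by simp [hq, hr], ?_⟩
      rw [map_add, map_mul, Module.End.mul_apply, Module.End.mul_apply, hrw, map_zero, add_zero,
        ← Module.End.mul_apply, ← map_mul, mul_comm, map_mul, Module.End.mul_apply, hqw, map_zero]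
  have := hpoly q _ h
  by_cases he₀ : e = 0
  · rw [he₀]; exact p.zero_mem
  rw [map_add, hqw, add_zero, Module.End.aeval_apply_of_hasEigenvector ⟨he, he₀⟩] at this
  exact (p.smul_mem_iff hqc).mp this

end Eigenspace

section AdSubalgebra

variable {K L : Type*} [Field K] [LieRing L] [LieAlgebra K L]

variable (K) in
/-- The subalgebra spanned by the homogeneous elements with degrees in a given set. -/
def LieAlgebra.adSubalgebra (d : L) (s : Set ℤ) (hs : ∀ j ∈ s, ∀ k ∈ s, j + k ∈ s) :
    LieSubalgebra K L :=
  { (⨆ k ∈ s, adPart K d k : Submodule K L) with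
    lie_mem' := fun {x y} hx hy ↦ by
      simp only [AddSubsemigroup.mem_carrier, AddSubmonoid.mem_toSubsemigroup,
        Submodule.mem_toAddSubmonoid] at hx hy ⊢
      rw [iSup_subtype'] at hx hy
      induction hx using Submodule.iSup_induction' with
      | mem j x hx =>
        induction hy using Submodule.iSup_induction' with
        | mem k y hy =>
          exact Submodule.mem_iSup_of_mem (j + k : ℤ) <|
            Submodule.mem_iSup_of_mem (hs j j.2 k k.2) (lie_mem_adPart hx hy)
        | zero => simp
        | add y y' _ _ h h' => rw [lie_add]; exact add_mem h h'
      | zero => simp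
      | add x x' _ _ h h' => rw [add_lie]; exact add_mem h h' }

theorem LieAlgebra.adSubalgebra_toSubmodule (d : L) (s : Set ℤ)
    (hs : ∀ j ∈ s, ∀ k ∈ s, j + k ∈ s) :
    (adSubalgebra K d s hs).toSubmodule = ⨆ k ∈ s, adPart K d k := rfl

end AdSubalgebra

/-! ### The height grading of the Lie algebra, and properness of the Verma ideal -/

namespace HighestWeight

open LieAlgebra LieAlgebra.IsKilling Module LieModule

variable {L : Type*} [LieRing L] [LieAlgebra ℂ L] [FiniteDimensional ℂ L] [IsKilling ℂ L]
  {H : LieSubalgebra ℂ L} [H.IsCartanSubalgebra]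

/-- `d` is the element of the Cartan subalgebra on which all simple roots take the value `1`. -/
def IsGradingElement (b : (rootSystem H).Base) (d : H) : Prop :=
  ∀ i ∈ b.support, (rootSystem H).root i d = 1

variable (b : (rootSystem H).Base)

theorem exists_isGradingElement : ∃ d : H, IsGradingElement b d := by
  refine ⟨(evalEquiv ℂ H).symm (b.toWeightBasis.constr ℂ fun _ ↦ 1), fun i hi ↦ ?_⟩
  rw [apply_evalEquiv_symm_apply]
  have := b.toWeightBasis.constr_basis ℂ (fun _ ↦ (1 : ℂ)) ⟨i, hi⟩
  rwa [b.toWeightBasis_apply] at this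

variable {b} {d : H} (hd : IsGradingElement b d)
include hd

theorem IsGradingElement.root_apply (i : H.root) : (rootSystem H).root i d = b.height i := by
  obtain ⟨f, -, -, hf⟩ := b.exists_root_eq_sum_int i
  rw [b.height_eq_sum hf, hf]
  rw [LinearMap.sum_apply, Int.cast_sum]
  refine Finset.sum_congr rfl fun j hj ↦ ?_
  rw [LinearMap.smul_apply, hd j hj, zsmul_one]

theorem IsGradingElement.rootSpace_le (i : H.root) :
    (rootSpace H (i : Weight ℂ H L)).toSubmodule ≤ adPart ℂ (d : L) (b.height i) := by
  intro x hx
  rw [mem_adPart, ← hd.root_apply i]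
  exact lie_eq_smul_of_mem_rootSpace hx d

omit hd in
theorem toSubmodule_le_adPart (d : H) : H.toSubmodule ≤ adPart ℂ (d : L) 0 := by
  intro x hx
  rw [mem_adPart, Int.cast_zero, zero_smul]
  exact congr_arg Subtype.val (trivial_lie_zero H H d ⟨x, hx⟩)

/-- The right-hand sides span `L` by the root decomposition and are contained in the independent
family of eigenspaces, so every inclusion is an equality. -/
theorem IsGradingElement.adPart_eq (k : ℤ) : adPart ℂ (d : L) k =
    (⨆ (_ : k = 0), H.toSubmodule) ⊔
      ⨆ i, ⨆ (_ : b.height i = k), (rootSpace H (i : Weight ℂ H L)).toSubmodule := by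
  let G (k : ℤ) : Submodule ℂ L := (⨆ (_ : k = 0), H.toSubmodule) ⊔
    ⨆ i, ⨆ (_ : b.height i = k), (rootSpace H (i : Weight ℂ H L)).toSubmodule
  refine (congr_fun (((iSupIndep_adPart ℂ (d : L)).le_iff_eq_of_iSup_eq_top (f := G) ?_).mp
    fun k ↦ ?_) k).symm
  · rw [eq_top_iff, ← LieSubmodule.top_toSubmodule (R := ℂ) (L := H) (M := L),
      ← cartan_sup_iSup_rootSpace_eq_top H]
    simp only [LieSubmodule.sup_toSubmodule, LieSubmodule.iSup_toSubmodule]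
    refine sup_le (le_iSup_of_le 0 (le_sup_of_le_left (le_iSup_of_le rfl le_rfl)))
      (iSup₂_le fun α hα ↦ ?_)
    let i : H.root := ⟨α, by simpa using hα⟩
    exact le_iSup_of_le (b.height i) (le_sup_of_le_right (le_iSup₂_of_le i rfl le_rfl))
  · refine sup_le (iSup_le ?_) (iSup₂_le ?_)
    · rintro rfl
      exact toSubmodule_le_adPart d
    · rintro i rfl
      exact hd.rootSpace_le i

theorem IsGradingElement.adPart_zero : adPart ℂ (d : L) 0 = H.toSubmodule := by
  rw [hd.adPart_eq]
  simp [b.height_ne_zero]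

theorem IsGradingElement.adPart_of_ne_zero {k : ℤ} (hk : k ≠ 0) : adPart ℂ (d : L) k =
      ⨆ i, ⨆ (_ : b.height i = k), (rootSpace H (i : Weight ℂ H L)).toSubmodule := by
  rw [hd.adPart_eq]
  simp [hk]

theorem IsGradingElement.iSup_adPart : ⨆ k, adPart ℂ (d : L) k = ⊤ := by
  rw [eq_top_iff, ← LieSubmodule.top_toSubmodule (R := ℂ) (L := H) (M := L),
    ← cartan_sup_iSup_rootSpace_eq_top H]
  simp only [LieSubmodule.sup_toSubmodule, LieSubmodule.iSup_toSubmodule]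
  refine sup_le (le_iSup_of_le 0 (toSubmodule_le_adPart d)) (iSup₂_le fun α hα ↦ ?_)
  exact le_iSup_of_le _ (hd.rootSpace_le ⟨α, by simpa using hα⟩)

omit hd in
/-- The linear form on `L` extending `nu` by zero on the root spaces. -/
theorem exists_extension (d : H) (nu : Dual ℂ H) : ∃ χ : L →ₗ[ℂ] ℂ, (∀ h : H, χ h = nu h) ∧
    ∀ k : ℤ, k ≠ 0 → ∀ x ∈ adPart ℂ (d : L) k, χ x = 0 := by
  -- Pairing with the element of `H` dual to `nu`; invariance of the Killing form makes `H`
  -- orthogonal to every eigenspace of `ad d` of nonzero degree.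
  refine ⟨killingForm ℂ L ((cartanEquivDual H).symm nu : L), fun h ↦ ?_, fun k hk x hx ↦ ?_⟩
  · exact DFunLike.congr_fun ((cartanEquivDual H).apply_symm_apply nu) h
  · have h₁ : ⁅(((cartanEquivDual H).symm nu : H) : L), (d : L)⁆ = 0 :=
      congr_arg Subtype.val (trivial_lie_zero H H ((cartanEquivDual H).symm nu) d)
    have h₂ := traceForm_apply_lie_apply ℂ L L ((cartanEquivDual H).symm nu : L) (d : L) x
    rw [h₁, map_zero, LinearMap.zero_apply, mem_adPart.mp hx, map_smul, eq_comm,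
      smul_eq_mul, mul_eq_zero, Int.cast_eq_zero] at h₂
    exact h₂.resolve_left hk

/-- The parts of negative and of nonnegative height are complementary subalgebras. The extension `χ`
of `nu` kills brackets within the nonnegative part: in positive degree by construction, in degree
zero because `H` is abelian. The generators of `vermaIdeal` are then among the elements `x - χ x`
with `x` in that part. -/
theorem vermaIdeal_ne_top (nu : Dual ℂ H) : vermaIdeal b nu ≠ ⊤ := by
  obtain ⟨χ, hχ, hχ₀⟩ := exists_extension d nu
  let N := adSubalgebra ℂ (d : L) {k | k < 0} fun j hj k hk ↦ Int.add_neg hj hk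
  let B := adSubalgebra ℂ (d : L) {k | 0 ≤ k} fun j hj k hk ↦ Int.add_nonneg hj hk
  have hNB : IsCompl N.toSubmodule B.toSubmodule := by
    constructor
    · rw [adSubalgebra_toSubmodule, adSubalgebra_toSubmodule]
      refine (iSupIndep_adPart ℂ (d : L)).disjoint_biSup_biSup ?_
      rw [Set.disjoint_left]
      intro k hk hk'
      exact absurd hk' (not_le_of_gt (show k < 0 from hk))
    · rw [codisjoint_iff, eq_top_iff, ← hd.iSup_adPart]
      refine iSup_le fun k ↦ ?_
      rcases lt_or_ge k 0 with hk | hk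
      · exact le_sup_of_le_left (le_iSup₂_of_le k hk le_rfl)
      · exact le_sup_of_le_right (le_iSup₂_of_le k hk le_rfl)
  have hB (x) (hx : x ∈ B) (y) (hy : y ∈ B) : χ ⁅x, y⁆ = 0 := by
    replace hx : x ∈ ⨆ k ∈ {k : ℤ | 0 ≤ k}, adPart ℂ (d : L) k := hx
    replace hy : y ∈ ⨆ k ∈ {k : ℤ | 0 ≤ k}, adPart ℂ (d : L) k := hy
    rw [iSup_subtype'] at hx hy
    induction hx using Submodule.iSup_induction' with
    | mem j x hx =>
      induction hy using Submodule.iSup_induction' with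
      | mem k y hy =>
        by_cases hjk : (j + k : ℤ) = 0
        · have hj : (j : ℤ) = 0 := by
            have h₁ : (0 : ℤ) ≤ j := j.2
            have h₂ : (0 : ℤ) ≤ k := k.2
            lia
          have hk : (k : ℤ) = 0 := by lia
          rw [hj, hd.adPart_zero] at hx
          rw [hk, hd.adPart_zero] at hy
          have : ⁅x, y⁆ = 0 := congr_arg Subtype.val (trivial_lie_zero H H ⟨x, hx⟩ ⟨y, hy⟩)
          rw [this, map_zero]
        · exact hχ₀ _ hjk _ (lie_mem_adPart hx hy)
      | zero => simp
      | add y y' _ _ h h' => rw [lie_add, map_add, h, h', add_zero]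
    | zero => simp
    | add x x' _ _ h h' => rw [add_lie, map_add, h, h', add_zero]
  refine ne_top_of_le_ne_top
    (UniversalEnvelopingAlgebra.span_sub_character_ne_top N hNB χ hB) ?_
  refine Submodule.span_mono ?_
  rintro u (⟨i, hi, x, hx, rfl⟩ | ⟨h, rfl⟩)
  · have hx' : x ∈ adPart ℂ (d : L) (b.height i) := hd.rootSpace_le i hx
    refine ⟨x, ?_, ?_⟩
    · exact Submodule.mem_iSup_of_mem (b.height i) (Submodule.mem_iSup_of_mem hi.le hx')
    · rw [hχ₀ _ (b.height_ne_zero i) x hx', map_zero, sub_zero]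
  · refine ⟨h, ?_, by rw [hχ]⟩
    exact Submodule.mem_iSup_of_mem 0
      (Submodule.mem_iSup_of_mem (le_refl (0 : ℤ)) (toSubmodule_le_adPart d h.2))

end HighestWeight

/-! ### Irreducible highest weight modules and root strings of weights -/

namespace HighestWeight

open LieAlgebra LieAlgebra.IsKilling Module LieModule

variable {L : Type*} [LieRing L] [LieAlgebra ℂ L] [FiniteDimensional ℂ L] [IsKilling ℂ L]
  {H : LieSubalgebra ℂ L} [H.IsCartanSubalgebra]

/-- The Lie algebra `L` acts on the Verma module through the universal enveloping algebra. -/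
instance instLieRingModuleVerma (b : (rootSystem H).Base) (nu : Dual ℂ H) :
    LieRingModule L (Verma b nu) where
  bracket x m := UniversalEnvelopingAlgebra.ι ℂ x • m
  add_lie x y m := by
    rw [map_add, add_smul]
  lie_add x m n := smul_add _ m n
  leibniz_lie x y m := by
    let _ : LieRing (UniversalEnvelopingAlgebra ℂ L) := LieRing.ofAssociativeRing
    change _ • _ • m = UniversalEnvelopingAlgebra.ι ℂ ⁅x, y⁆ • m + _ • _ • m
    rw [LieHom.map_lie, LieRing.of_associative_ring_bracket, sub_smul, mul_smul, mul_smul,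
      sub_add_cancel]

instance instLieModuleVerma (b : (rootSystem H).Base) (nu : Dual ℂ H) :
    LieModule ℂ L (Verma b nu) where
  smul_lie c x m := by
    change UniversalEnvelopingAlgebra.ι ℂ (c • x) • m = c • (UniversalEnvelopingAlgebra.ι ℂ x • m)
    rw [map_smul, smul_assoc]
  lie_smul c x m := by
    change UniversalEnvelopingAlgebra.ι ℂ x • c • m = c • (UniversalEnvelopingAlgebra.ι ℂ x • m)
    rw [smul_comm]

variable (b : (rootSystem H).Base) (nu : Dual ℂ H)

/-- The canonical generator of the Verma module. -/
def vermaGen : Verma b nu := Submodule.Quotient.mk 1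

/-- The canonical generator of the irreducible highest weight module. -/
def irrGen : Irr b nu := Submodule.Quotient.mk (vermaGen b nu)

theorem mk_lie_irr (x : L) (m : Verma b nu) :
    (Submodule.Quotient.mk ⁅x, m⁆ : Irr b nu) = ⁅x, (Submodule.Quotient.mk m : Irr b nu)⁆ := rfl

theorem lie_vermaGen_of_isPos {i : H.root} (hi : b.IsPos i) {x : L}
    (hx : x ∈ rootSpace H (i : Weight ℂ H L)) : ⁅x, vermaGen b nu⁆ = 0 := by
  change Submodule.Quotient.mk (UniversalEnvelopingAlgebra.ι ℂ x • 1) = _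
  rw [smul_eq_mul, mul_one, Submodule.Quotient.mk_eq_zero]
  exact Submodule.subset_span (.inl ⟨i, hi, x, hx, rfl⟩)

theorem lie_vermaGen_of_mem (h : H) : ⁅(h : L), vermaGen b nu⁆ = nu h • vermaGen b nu := by
  change Submodule.Quotient.mk (UniversalEnvelopingAlgebra.ι ℂ (h : L) • 1) =
    Submodule.Quotient.mk (nu h • 1)
  rw [Submodule.Quotient.eq, smul_eq_mul, mul_one, ← Algebra.algebraMap_eq_smul_one]
  exact Submodule.subset_span (.inr ⟨h, rfl⟩)

theorem mem_lieSpan_vermaGen (m : Verma b nu) : m ∈ LieSubmodule.lieSpan ℂ L {vermaGen b nu} := by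
  obtain ⟨u, rfl⟩ := Submodule.Quotient.mk_surjective _ m
  induction u using UniversalEnvelopingAlgebra.induction_mul_left with
  | one => exact LieSubmodule.subset_lieSpan rfl
  | add u v hu hv => exact add_mem hu hv
  | smul r u hu => exact (LieSubmodule.lieSpan ℂ L {vermaGen b nu}).toSubmodule.smul_mem r hu
  | mul x u hu => exact LieSubmodule.lie_mem (x := x) _ hu

theorem lieSpan_vermaGen : LieSubmodule.lieSpan ℂ L {vermaGen b nu} = ⊤ :=
  eq_top_iff.mpr fun m _ ↦ mem_lieSpan_vermaGen b nu m

theorem lieSpan_irrGen : LieSubmodule.lieSpan ℂ L {irrGen b nu} = ⊤ := by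
  let f : Verma b nu →ₗ⁅ℂ, L⁆ Irr b nu :=
    { (vermaRadical b nu).mkQ.restrictScalars ℂ with map_lie' := fun {x m} ↦ rfl }
  refine eq_top_iff.mpr fun m _ ↦ ?_
  obtain ⟨m, rfl⟩ := Submodule.Quotient.mk_surjective _ m
  have h : LieSubmodule.lieSpan ℂ L {vermaGen b nu} ≤
      (LieSubmodule.lieSpan ℂ L {irrGen b nu}).comap f := by
    rw [LieSubmodule.lieSpan_le, Set.singleton_subset_iff]
    exact LieSubmodule.subset_lieSpan rfl
  exact h (mem_lieSpan_vermaGen b nu m)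

variable {b} {d : H} (hd : IsGradingElement b d)
include hd

theorem lie_vermaGen_mem_span (k : ℤ) (hk : 0 ≤ k) (x : L) (hx : x ∈ adPart ℂ (d : L) k) :
    ⁅x, vermaGen b nu⁆ ∈ ℂ ∙ vermaGen b nu := by
  rcases hk.eq_or_lt with rfl | hk
  · rw [hd.adPart_zero] at hx
    rw [lie_vermaGen_of_mem b nu ⟨x, hx⟩]
    exact Submodule.smul_mem _ _ (Submodule.mem_span_singleton_self _)
  · rw [hd.adPart_of_ne_zero hk.ne', iSup_subtype'] at hx
    suffices ⁅x, vermaGen b nu⁆ = 0 by simp [this]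
    induction hx using Submodule.iSup_induction' with
    | mem i x hx => exact lie_vermaGen_of_isPos b nu (b.isPos_iff.mpr (hk.trans_eq i.2.symm)) hx
    | zero => simp
    | add x x' _ _ h h' => rw [add_lie, h, h', add_zero]

theorem lie_irrGen_mem_span (k : ℤ) (hk : 0 ≤ k) (x : L) (hx : x ∈ adPart ℂ (d : L) k) :
    ⁅x, irrGen b nu⁆ ∈ ℂ ∙ irrGen b nu := by
  obtain ⟨a, ha⟩ := Submodule.mem_span_singleton.mp (lie_vermaGen_mem_span nu hd k hk x hx)
  rw [irrGen, ← mk_lie_irr, ← ha]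
  exact Submodule.smul_mem _ a (Submodule.mem_span_singleton_self _)

theorem vermaGen_ne_zero : vermaGen b nu ≠ 0 := by
  intro h
  rw [vermaGen, Submodule.Quotient.mk_eq_zero] at h
  exact vermaIdeal_ne_top hd nu (Ideal.eq_top_iff_one (vermaIdeal b nu) |>.mpr h)

/-- A proper submodule of the Verma module lies in the sum of the lower weight spaces. -/
theorem mem_iSup_eigenspace_of_ne_top
    {N : Submodule (UniversalEnvelopingAlgebra ℂ L) (Verma b nu)} (hN : N ≠ ⊤)
    {m : Verma b nu} (hm : m ∈ N) :
    m ∈ ⨆ a, ⨆ (_ : a ≠ nu d), (toEnd ℂ L (Verma b nu) d).eigenspace a := by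
  -- Case `j = 0`: the eigenspace for `nu d` is the line through `vermaGen`, so a nonzero component
  -- there would put the generator into `N`.
  have hE := lowering_eq_eigenspace hd.iSup_adPart (lie_vermaGen_mem_span nu hd)
    (lieSpan_vermaGen b nu) (lie_vermaGen_of_mem b nu d) 0
  rw [lowering, Nat.cast_zero, sub_zero] at hE
  have htop := LieModule.iSup_eigenspace_eq_top hd.iSup_adPart (lie_vermaGen_mem_span nu hd)
    (lieSpan_vermaGen b nu) (lie_vermaGen_of_mem b nu d)
  have hm' : m ∈ (toEnd ℂ L (Verma b nu) d).eigenspace (nu d) ⊔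
      ⨆ a, ⨆ (_ : a ≠ nu d), (toEnd ℂ L (Verma b nu) d).eigenspace a := by
    rw [← iSup_split_single, htop]
    trivial
  obtain ⟨e, he, w, hw, rfl⟩ := Submodule.mem_sup.mp hm'
  have heN : e ∈ N.restrictScalars ℂ :=
    Module.End.mem_of_add_mem_of_mem_eigenspace (f := toEnd ℂ L (Verma b nu) d)
      (fun x hx ↦ N.smul_mem (UniversalEnvelopingAlgebra.ι ℂ (d : L)) hx) he hw hm
  obtain ⟨a, rfl⟩ := Submodule.mem_span_singleton.mp (hE ▸ he)
  by_cases ha : a = 0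
  · rwa [ha, zero_smul, zero_add]
  · refine (hN (eq_top_iff.mpr fun x _ ↦ ?_)).elim
    have hv : vermaGen b nu ∈ N := ((N.restrictScalars ℂ).smul_mem_iff ha).mp heN
    obtain ⟨u, rfl⟩ := Submodule.Quotient.mk_surjective _ x
    have := N.smul_mem u hv
    rwa [vermaGen, ← Submodule.Quotient.mk_smul, smul_eq_mul, mul_one] at this

/-- Every proper submodule lies in the sum of the eigenspaces for eigenvalues other than `nu d`,
hence so does their sum; the generator has eigenvalue `nu d` and is nonzero. -/
theorem irrGen_ne_zero : irrGen b nu ≠ 0 := by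
  intro h
  rw [irrGen, Submodule.Quotient.mk_eq_zero, vermaRadical, sSup_eq_iSup'] at h
  have hmem : vermaGen b nu ∈ ⨆ a, ⨆ (_ : a ≠ nu d),
      (toEnd ℂ L (Verma b nu) d).eigenspace a := by
    generalize vermaGen b nu = m at h
    induction h using Submodule.iSup_induction' with
    | mem N m hm => exact mem_iSup_eigenspace_of_ne_top nu hd N.2 hm
    | zero => exact Submodule.zero_mem _
    | add m m' _ _ h h' => exact add_mem h h'
  have hE : vermaGen b nu ∈ (toEnd ℂ L (Verma b nu) d).eigenspace (nu d) := by
    rw [Module.End.mem_eigenspace_iff]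
    exact lie_vermaGen_of_mem b nu d
  exact vermaGen_ne_zero nu hd <| Submodule.disjoint_def.mp
    (Module.End.eigenspaces_iSupIndep (toEnd ℂ L (Verma b nu) d) (nu d)) _ hE hmem

/-- Needed because `finrank` is `0` on infinite-dimensional spaces, so that without it a nonzero
weight vector would not give nonzero multiplicity. The weight space sits in an eigenspace of `d`,
which is finitely generated or zero. -/
theorem finiteDimensional_weightSpace (mu : Dual ℂ H) :
    FiniteDimensional ℂ (weightSpace (R := ℂ) (L := H) (Irr b nu) (fun h ↦ mu h)) := by
  have hc : ⁅(d : L), irrGen b nu⁆ = nu d • irrGen b nu := by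
    rw [irrGen, ← mk_lie_irr, lie_vermaGen_of_mem]
    rfl
  have hle : (weightSpace (R := ℂ) (L := H) (Irr b nu) (fun h ↦ mu h)).toSubmodule ≤
      (toEnd ℂ L (Irr b nu) d).eigenspace (mu d) := by
    intro m hm
    rw [Module.End.mem_eigenspace_iff]
    exact (mem_weightSpace _ m).mp hm d
  by_cases ha : ∃ j : ℕ, mu d = nu d - j
  · obtain ⟨j, hj⟩ := ha
    rw [hj, ← lowering_eq_eigenspace hd.iSup_adPart (lie_irrGen_mem_span nu hd)
      (lieSpan_irrGen b nu) hc j] at hle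
    have : FiniteDimensional ℂ (lowering ℂ (d : L) (irrGen b nu) j) :=
      Module.Finite.iff_fg.mpr (lowering_fg _ _ j)
    exact Submodule.finiteDimensional_of_le hle
  · push Not at ha
    rw [eigenspace_eq_bot hd.iSup_adPart (lie_irrGen_mem_span nu hd) (lieSpan_irrGen b nu) hc ha]
      at hle
    exact Submodule.finiteDimensional_of_le hle

omit hd in
variable (b) in
theorem multiplicity_ne_zero_iff (mu : Dual ℂ H) : multiplicity b nu mu ≠ 0 ↔
    ∃ m : Irr b nu, m ≠ 0 ∧ ∀ h : H, ⁅(h : L), m⁆ = mu h • m := by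
  obtain ⟨d, hd⟩ := exists_isGradingElement b
  have := finiteDimensional_weightSpace nu hd mu
  rw [multiplicity, ← Nat.pos_iff_ne_zero, Module.finrank_pos_iff_exists_ne_zero]
  constructor
  · rintro ⟨⟨m, hm⟩, hm₀⟩
    exact ⟨m, by simpa using hm₀, (mem_weightSpace _ m).mp hm⟩
  · rintro ⟨m, hm₀, hm⟩
    exact ⟨⟨m, (mem_weightSpace _ m).mpr hm⟩, by simpa using hm₀⟩

omit hd in
variable (b) in
theorem multiplicity_self_ne_zero : multiplicity b nu nu ≠ 0 := by
  obtain ⟨d, hd⟩ := exists_isGradingElement b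
  refine (multiplicity_ne_zero_iff b nu nu).mpr ⟨irrGen b nu, irrGen_ne_zero nu hd, fun h ↦ ?_⟩
  rw [irrGen, ← mk_lie_irr, lie_vermaGen_of_mem]
  rfl

omit hd in
theorem lie_pow_weight {M : Type*} [AddCommGroup M] [Module ℂ M] [LieRingModule L M]
    [LieModule ℂ L M] {chi : H → ℂ} {x : L} (hx : x ∈ rootSpace H chi) {mu : Dual ℂ H} {m : M}
    (hm : ∀ h : H, ⁅(h : L), m⁆ = mu h • m) (n : ℕ) (h : H) :
    ⁅(h : L), (toEnd ℂ L M x ^ n) m⁆ = (mu h + n * chi h) • (toEnd ℂ L M x ^ n) m := by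
  induction n with
  | zero => simp [hm h]
  | succ n ih =>
    have hx' : ⁅(h : L), x⁆ = chi h • x := lie_eq_smul_of_mem_rootSpace hx h
    rw [pow_succ', Module.End.mul_apply, toEnd_apply_apply, leibniz_lie, hx', ih, smul_lie,
      lie_smul, ← add_smul]
    congr 1
    push_cast
    ring

omit hd in
/-- The weights are closed under strings in the direction of a negative root. -/
theorem multiplicity_sub_nsmul_ne_zero {mu : Dual ℂ H} {i : H.root} (hi : b.IsPos i) {m k : ℕ}
    (hm : mu ((rootSystem H).coroot i) = m) (hk : k ≤ m) (hmu : multiplicity b nu mu ≠ 0) :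
    multiplicity b nu (mu - k • (rootSystem H).root i) ≠ 0 := by
  obtain ⟨d, hd⟩ := exists_isGradingElement b
  rw [multiplicity_ne_zero_iff] at hmu ⊢
  obtain ⟨v, hv₀, hv⟩ := hmu
  have hα : (i : Weight ℂ H L).IsNonZero := H.isNonZero_coe_root i
  obtain ⟨h, e, f, t, he, hf⟩ := exists_isSl2Triple_of_weight_isNonZero hα
  obtain rfl : h = coroot (i : Weight ℂ H L) := t.h_eq_coroot hα he hf
  have hc : ⁅(d : L), irrGen b nu⁆ = nu d • irrGen b nu := by
    rw [irrGen, ← mk_lie_irr, lie_vermaGen_of_mem]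
    rfl
  have hnil := exists_pow_toEnd_eq_zero hd.iSup_adPart (lie_irrGen_mem_span nu hd)
    (lieSpan_irrGen b nu) hc hi (hd.rootSpace_le i he)
    (Module.End.mem_eigenspace_iff.mpr (hv d) : v ∈ (toEnd ℂ L (Irr b nu) d).eigenspace (mu d))
  classical
  obtain ⟨n, hn⟩ : ∃ n, Nat.find hnil = n + 1 := by
    refine Nat.exists_eq_add_one_of_ne_zero fun h₀ ↦ hv₀ ?_
    have := Nat.find_spec hnil
    rwa [h₀, pow_zero] at this
  -- The last nonzero vector on the `e`-string through `v`; it is primitive, with `h`-eigenvalue `m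
  -- + 2 * n`.
  set u := (toEnd ℂ L (Irr b nu) e ^ n) v with hu
  have hu₀ : u ≠ 0 := Nat.find_min hnil (by lia)
  have hαc : (i : Weight ℂ H L) (coroot (i : Weight ℂ H L)) = 2 := root_apply_coroot hα
  let mu' : Dual ℂ H := mu + n • (rootSystem H).root i
  have hmu' (h : H) : mu' h = mu h + n * (i : Weight ℂ H L) h := by simp [mu']
  have huw (h : H) : ⁅(h : L), u⁆ = mu' h • u := by rw [hmu']; exact lie_pow_weight he hv n h
  have hm' : mu (coroot (i : Weight ℂ H L)) = m := hm
  have P : t.HasPrimitiveVectorWith u ((m : ℂ) + 2 * n) :=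
    { ne_zero := hu₀
      lie_h := by rw [huw, hmu', hαc, hm', mul_comm]
      lie_e := by
        have := Nat.find_spec hnil
        rwa [hn, pow_succ'] at this }
  -- The scalar in `e f ^ (j + 1) u = (j + 1) (m + 2 n - j) f ^ j u` is nonzero as long as `j < m +
  -- 2 n`.
  have hfu (j : ℕ) (hj : j ≤ m + 2 * n) : (toEnd ℂ L (Irr b nu) f ^ j) u ≠ 0 := by
    induction j with
    | zero => exact hu₀
    | succ j ih =>
      intro h₀
      have h₁ := P.lie_e_pow_succ_toEnd_f j
      rw [h₀, lie_zero, eq_comm, smul_eq_zero, or_iff_left (ih (by lia)), mul_eq_zero] at h₁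
      rcases h₁ with h₁ | h₁
      · exact Nat.cast_add_one_ne_zero j h₁
      · rw [sub_eq_zero] at h₁
        norm_cast at h₁
        lia
  -- Lowering `n` times returns to weight `mu`, and `k` further times gives the target; `k ≤ m`
  -- keeps `n + k` within the nonvanishing range.
  refine ⟨(toEnd ℂ L (Irr b nu) f ^ (n + k)) u, hfu _ (by lia), fun h ↦ ?_⟩
  rw [lie_pow_weight hf huw (n + k) h, hmu']
  congr 1
  simp
  ring

end HighestWeight

/-! ### Positivity of dominant weights in the basis of simple roots -/

namespace RootPairing

variable {ι M N : Type*} [AddCommGroup M] [Module ℂ M] [AddCommGroup N] [Module ℂ N]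
  {P : RootPairing ι ℂ M N} [P.IsCrystallographic]

/-- This is `2 (α_j, α_i) = ⟨α_j, α_i^∨⟩ (α_i, α_i)` for the canonical form `(x, y) = ∑ r, r^∨(x)
r^∨(y)`, written in integers so that it can be cast to `ℝ`. -/
theorem two_mul_sum_pairingIn_mul_pairingIn [Fintype ι] (i j : ι) :
    2 * ∑ r, P.pairingIn ℤ j r * P.pairingIn ℤ i r =
      P.pairingIn ℤ j i * ∑ r, P.pairingIn ℤ i r * P.pairingIn ℤ i r := by
  have h := P.toInvariantForm.two_mul_apply_root_root j i
  simp only [toInvariantForm_form, rootForm_apply_apply, root_coroot'_eq_pairing,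
    ← P.algebraMap_pairingIn ℤ, algebraMap_int_eq, eq_intCast] at h
  exact_mod_cast h

namespace Base

variable [P.IsRootSystem] (b : P.Base)

omit [P.IsCrystallographic] in
theorem eq_zero_of_forall_coroot' {x : M} (h : ∀ i ∈ b.support, P.coroot' i x = 0) : x = 0 := by
  rw [P.eq_zero_iff_forall_coroot'_eq_zero]
  intro i
  have hi := b.coroot_mem_span_int i
  change P.toLinearMap x (P.coroot i) = 0
  generalize P.coroot i = y at hi
  induction hi using Submodule.span_induction with
  | mem y hy => obtain ⟨j, hj, rfl⟩ := hy; exact h j hj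
  | zero => simp
  | add y z _ _ hy hz => rw [map_add, hy, hz, add_zero]
  | smul n y _ hy => rw [map_zsmul, hy, smul_zero]

theorem coroot'_apply_eq_sum (x : M) (i : ι) :
    P.coroot' i x = ∑ j, b.toWeightBasis.repr x j * (P.pairingIn ℤ j i : ℂ) := by
  conv_lhs => rw [← b.toWeightBasis.sum_repr x]
  rw [map_sum]
  refine Finset.sum_congr rfl fun j _ ↦ ?_
  rw [map_smul, b.toWeightBasis_apply, root_coroot'_eq_pairing, ← P.algebraMap_pairingIn ℤ]
  rfl

theorem re_coroot'_apply_eq_sum (x : M) (i : ι) :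
    (P.coroot' i x).re = ∑ j, (b.toWeightBasis.repr x j).re * (P.pairingIn ℤ j i : ℝ) := by
  rw [b.coroot'_apply_eq_sum, Complex.re_sum]
  refine Finset.sum_congr rfl fun j _ ↦ ?_
  rw [← Complex.ofReal_intCast, Complex.re_mul_ofReal]

/-- A form of the positive definiteness of the invariant form on the real span of the roots. -/
theorem exists_pos_mul_sum_pairingIn [Finite ι] {t : b.support → ℝ} (ht : t ≠ 0) :
    ∃ i, 0 < t i * ∑ j, t j * (P.pairingIn ℤ j i : ℝ) := by
  have := Fintype.ofFinite ι
  by_contra! hcon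
  -- With `x = ∑ t_j α_j`, `a r` is `r^∨(x)`, so `∑ (a r)² = (x, x)`; by `h₁`, twice this is `∑ t_i
  -- a_i (α_i, α_i)`. If every `t_i a_i ≤ 0`, then all `a r` vanish and `x = 0`.
  let a (r : ι) : ℝ := ∑ j, t j * (P.pairingIn ℤ j r : ℝ)
  have hlen (i : ι) : (0 : ℝ) ≤ ∑ r, (P.pairingIn ℤ i r : ℝ) * P.pairingIn ℤ i r :=
    Finset.sum_nonneg fun r _ ↦ mul_self_nonneg _
  have hB (i j : ι) : 2 * ∑ r, (P.pairingIn ℤ j r : ℝ) * P.pairingIn ℤ i r =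
      P.pairingIn ℤ j i * ∑ r, (P.pairingIn ℤ i r : ℝ) * P.pairingIn ℤ i r := by
    exact_mod_cast two_mul_sum_pairingIn_mul_pairingIn (P := P) i j
  have h₁ : 2 * ∑ r, a r * a r =
      ∑ i, (t i * a i) * ∑ r, (P.pairingIn ℤ i r : ℝ) * P.pairingIn ℤ i r := by
    calc 2 * ∑ r, a r * a r
        = ∑ i, t i * ∑ j, t j * (2 * ∑ r, (P.pairingIn ℤ j r : ℝ) * P.pairingIn ℤ i r) := by
          have ha (r : ι) : a r * a r = ∑ i : b.support, ∑ j : b.support,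
              (t i * (P.pairingIn ℤ i r : ℝ)) * (t j * (P.pairingIn ℤ j r : ℝ)) :=
            Finset.sum_mul_sum _ _ _ _
          simp only [ha, Finset.mul_sum]
          rw [Finset.sum_comm]
          refine Finset.sum_congr rfl fun i _ ↦ ?_
          rw [Finset.sum_comm]
          refine Finset.sum_congr rfl fun j _ ↦ Finset.sum_congr rfl fun r _ ↦ ?_
          ring
      _ = _ := by
          refine Finset.sum_congr rfl fun i _ ↦ ?_
          simp only [hB, a]
          rw [mul_assoc, Finset.sum_mul]
          simp only [mul_assoc]
  have h₂ : ∑ r, a r * a r ≤ 0 := by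
    have : ∑ i : b.support, (t i * a i) * ∑ r, (P.pairingIn ℤ i r : ℝ) * P.pairingIn ℤ i r ≤ 0 :=
      Finset.sum_nonpos fun i _ ↦ mul_nonpos_of_nonpos_of_nonneg (hcon i) (hlen i)
    linarith
  have h₃ (r : ι) : a r = 0 := by
    have h := (Finset.sum_eq_zero_iff_of_nonneg fun r _ ↦ mul_self_nonneg (a r)).mp
      (h₂.antisymm (Finset.sum_nonneg fun r _ ↦ mul_self_nonneg (a r))) r (Finset.mem_univ r)
    exact mul_self_eq_zero.mp h
  have h₄ : ∑ j, (t j : ℂ) • b.toWeightBasis j = 0 := by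
    rw [P.eq_zero_iff_forall_coroot'_eq_zero]
    intro r
    rw [b.coroot'_apply_eq_sum]
    have h₅ : ((a r : ℝ) : ℂ) = 0 := by rw [h₃ r, Complex.ofReal_zero]
    simp only [a, Complex.ofReal_sum, Complex.ofReal_mul, Complex.ofReal_intCast] at h₅
    rw [← h₅]
    refine Finset.sum_congr rfl fun j _ ↦ ?_
    rw [Module.Basis.repr_sum_self]
  refine ht (funext fun j ↦ ?_)
  have := Fintype.linearIndependent_iff.mp b.toWeightBasis.linearIndependent _ h₄ j
  exact_mod_cast this

variable [Finite ι] {x : M} (hx : ∀ i ∈ b.support, ∃ k : ℕ, P.coroot' i x = k)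
include hx

/-- Otherwise the negative part `s = min t 0` is nonzero, and definiteness gives `i` with `s i < 0`
and `⟨s, α_i^∨⟩ < 0`. As `t` agrees with `s` at `i`, is at least `s` elsewhere, and off-diagonal
pairings are nonpositive, `⟨x, α_i^∨⟩ < 0`, against dominance. -/
theorem re_repr_nonneg (i : b.support) : 0 ≤ (b.toWeightBasis.repr x i).re := by
  let t (i : b.support) : ℝ := (b.toWeightBasis.repr x i).re
  let s (i : b.support) : ℝ := min (t i) 0
  by_contra! hi
  have hs : s ≠ 0 := fun h ↦ by
    have := congr_fun h i
    simp only [s, t, Pi.zero_apply, min_eq_right_iff] at this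
    exact not_le_of_gt hi this
  obtain ⟨i, hi⟩ := b.exists_pos_mul_sum_pairingIn hs
  have hsi : s i ≤ 0 := min_le_right _ _
  have hneg : ∑ j, s j * (P.pairingIn ℤ j i : ℝ) < 0 := by
    by_contra! h
    exact not_lt_of_ge (mul_nonpos_of_nonpos_of_nonneg hsi h) hi
  have hsi' : s i < 0 := hsi.lt_of_ne fun h ↦ by simp [h] at hi
  have hti : s i = t i := min_eq_left (by by_contra! h; simp [s, h.le] at hsi')
  obtain ⟨k, hk⟩ := hx i i.2
  have hre := b.re_coroot'_apply_eq_sum x i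
  rw [hk, Complex.natCast_re] at hre
  have hle : ∑ j, t j * (P.pairingIn ℤ j i : ℝ) ≤ ∑ j, s j * (P.pairingIn ℤ j i : ℝ) := by
    refine Finset.sum_le_sum fun j _ ↦ ?_
    rcases eq_or_ne j i with rfl | hji
    · rw [hti]
    · have h : (P.pairingIn ℤ j i : ℝ) ≤ 0 := by
        exact_mod_cast b.pairingIn_le_zero_of_ne (Subtype.coe_ne_coe.mpr hji) j.2 i.2
      exact mul_le_mul_of_nonpos_right (min_le_left _ _) h
  have : (0 : ℝ) ≤ k := k.cast_nonneg
  change (k : ℝ) = ∑ j, t j * (P.pairingIn ℤ j i : ℝ) at hre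
  linarith

/-- Nonzero dominant weights of an irreducible root system have positive coefficients with respect
to the simple roots. -/
theorem re_repr_pos [P.IsReduced] [P.IsIrreducible] (hx₀ : x ≠ 0) (i : b.support) :
    0 < (b.toWeightBasis.repr x i).re := by
  let t (i : b.support) : ℝ := (b.toWeightBasis.repr x i).re
  have ht (i : b.support) : 0 ≤ t i := b.re_repr_nonneg hx i
  -- When `t i = 0`, the expansion of the value at the `i`-th simple coroot has only nonpositive
  -- terms but a nonnegative sum, so every term is zero.
  have horth (i j : b.support) (hi : t i = 0) (hj : t j ≠ 0) : P.pairingIn ℤ j i = 0 := by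
    have hre := b.re_coroot'_apply_eq_sum x i
    obtain ⟨k, hk⟩ := hx i i.2
    rw [hk, Complex.natCast_re] at hre
    have hterm (l : b.support) (_ : l ∈ Finset.univ) : t l * (P.pairingIn ℤ l i : ℝ) ≤ 0 := by
      rcases eq_or_ne l i with rfl | hl
      · rw [hi, zero_mul]
      · have h : (P.pairingIn ℤ l i : ℝ) ≤ 0 := by
          exact_mod_cast b.pairingIn_le_zero_of_ne (Subtype.coe_ne_coe.mpr hl) l.2 i.2
        exact mul_nonpos_of_nonneg_of_nonpos (ht l) h
    have hsum : ∑ l, t l * (P.pairingIn ℤ l i : ℝ) = 0 :=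
      (Finset.sum_nonpos hterm).antisymm (by rw [← hre]; exact k.cast_nonneg)
    have := (Finset.sum_eq_zero_iff_of_nonpos hterm).mp hsum j (Finset.mem_univ j)
    exact_mod_cast (mul_eq_zero.mp this).resolve_left hj
  obtain ⟨j, hj⟩ : ∃ j, t j ≠ 0 := by
    by_contra! h
    refine hx₀ (b.eq_zero_of_forall_coroot' fun i hi ↦ ?_)
    obtain ⟨k, hk⟩ := hx i hi
    have hre := b.re_coroot'_apply_eq_sum x i
    rw [hk, Complex.natCast_re] at hre
    change (k : ℝ) = ∑ j, t j * (P.pairingIn ℤ j i : ℝ) at hre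
    simp only [h, zero_mul, Finset.sum_const_zero, Nat.cast_eq_zero] at hre
    rw [hk, hre, Nat.cast_zero]
  -- By `horth`, the span of the simple roots with nonzero coefficient is stable under all simple
  -- reflections; irreducibility makes it everything, and linear independence then leaves no zero
  -- coefficient.
  let q : Submodule ℂ M := Submodule.span ℂ (b.toWeightBasis '' {j | t j ≠ 0})
  have hmem (j : b.support) (hj : t j ≠ 0) : P.root j ∈ q :=
    Submodule.subset_span ⟨j, hj, b.toWeightBasis_apply j⟩
  have hinv : ∀ i ∈ b.support, q ∈ Module.End.invtSubmodule (P.reflection i) := by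
    intro i hi
    rw [Module.End.mem_invtSubmodule, Submodule.span_le]
    rintro - ⟨j, hj, rfl⟩
    change P.reflection i (b.toWeightBasis j) ∈ q
    rw [b.toWeightBasis_apply, P.reflection_apply_root]
    refine q.sub_mem (hmem j hj) ?_
    by_cases hi' : t ⟨i, hi⟩ = 0
    · have := horth ⟨i, hi⟩ j hi' hj
      rw [← P.algebraMap_pairingIn ℤ, this]
      simp
    · exact q.smul_mem _ (hmem ⟨i, hi⟩ hi')
  have hq : q = ⊤ := by
    refine IsIrreducible.eq_top_of_invtSubmodule_reflection q
      ((b.forall_mem_support_invtSubmodule_iff q).mp hinv) fun h ↦ ?_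
    have := hmem j hj
    rw [h, Submodule.mem_bot] at this
    exact P.ne_zero _ this
  refine (ht i).lt_of_ne fun h ↦ ?_
  exact b.toWeightBasis.linearIndependent.notMem_span_image (s := {j | t j ≠ 0}) (x := i)
    (fun h' ↦ h' h.symm) (by change _ ∈ q; rw [hq]; trivial)

end Base

end RootPairing

/-! ### Descent to dominant weights, reduction by reflections, and the theorem -/

namespace HighestWeight

open LieAlgebra LieAlgebra.IsKilling Module

variable {L : Type*} [LieRing L] [LieAlgebra ℂ L] [FiniteDimensional ℂ L] [IsKilling ℂ L]
  {H : LieSubalgebra ℂ L} [H.IsCartanSubalgebra] (b : (rootSystem H).Base)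

theorem exists_int_repr_eq {x : Dual ℂ H} (hx : x ∈ rootLattice H) (i : b.support) :
    ∃ z : ℤ, b.toWeightBasis.repr x i = z := by
  induction hx using AddSubgroup.closure_induction with
  | mem x hx =>
    obtain ⟨k, rfl⟩ := hx
    obtain ⟨f, -, -, hf⟩ := b.exists_root_eq_sum_int k
    refine ⟨f i, ?_⟩
    rw [hf, ← Finset.sum_coe_sort b.support]
    have : ∑ j : b.support, f j • (rootSystem H).root j =
        ∑ j : b.support, (f j : ℂ) • b.toWeightBasis j :=
      Finset.sum_congr rfl fun j _ ↦ by rw [b.toWeightBasis_apply, Int.cast_smul_eq_zsmul]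
    rw [this, Basis.repr_sum_self]
  | zero => exact ⟨0, by simp⟩
  | add x y _ _ hx hy =>
    obtain ⟨m, hm⟩ := hx
    obtain ⟨n, hn⟩ := hy
    exact ⟨m + n, by simp [hm, hn]⟩
  | neg x _ hx =>
    obtain ⟨m, hm⟩ := hx
    exact ⟨-m, by simp [hm]⟩

theorem exists_int_apply_coroot_eq {x : Dual ℂ H} (hx : x ∈ rootLattice H) (i : H.root) :
    ∃ z : ℤ, x ((rootSystem H).coroot i) = z := by
  induction hx using AddSubgroup.closure_induction with
  | mem x hx =>
    obtain ⟨k, rfl⟩ := hx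
    exact ⟨(rootSystem H).pairingIn ℤ k i, ((rootSystem H).algebraMap_pairingIn ℤ k i).symm⟩
  | zero => exact ⟨0, by simp⟩
  | add x y _ _ hx hy =>
    obtain ⟨m, hm⟩ := hx
    obtain ⟨n, hn⟩ := hy
    exact ⟨m + n, by simp only [LinearMap.add_apply, hm, hn, Int.cast_add]⟩
  | neg x _ hx =>
    obtain ⟨m, hm⟩ := hx
    exact ⟨-m, by simp only [LinearMap.neg_apply, hm, Int.cast_neg]⟩

/-- Dominant integral weights below a weight of `L(nu)` are weights of `L(nu)`. -/
theorem multiplicity_ne_zero_of_le {nu mu : Dual ℂ H} (hmu : IsDominantIntegral b mu)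
    (f : b.support → ℕ)
    (hf : multiplicity b nu (mu + ∑ i, f i • (rootSystem H).root i) ≠ 0) :
    multiplicity b nu mu ≠ 0 := by
  classical
  induction hs : ∑ i, f i generalizing f with
  | zero =>
    have : ∀ i, f i = 0 := by simpa using hs
    simpa [this] using hf
  | succ s ih =>
    have hf₀ : (fun i ↦ (f i : ℝ)) ≠ 0 := fun h ↦ by
      have : ∀ i, f i = 0 := fun i ↦ by simpa using congr_fun h i
      simp [this] at hs
    -- This `i` has `f i > 0` and `⟨∑ f_j α_j, α_i^∨⟩ > 0`. Since `mu` is dominant, the current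
    -- weight is positive on `α_i^∨`, so subtracting `α_i` yields another weight, still above `mu`.
    obtain ⟨i, hi⟩ := b.exists_pos_mul_sum_pairingIn hf₀
    obtain ⟨k, hk⟩ := hmu i i.2
    let z : ℤ := ∑ j : b.support, f j * (rootSystem H).pairingIn ℤ j i
    have hz : 0 < z := by
      have h : (0 : ℝ) < z := by
        push_cast [z]
        exact pos_of_mul_pos_right hi (Nat.cast_nonneg _)
      exact_mod_cast h
    have hfi : 0 < f i := by
      rw [Nat.pos_iff_ne_zero]
      intro h
      simp [h] at hi
    obtain ⟨m, hm⟩ : ∃ m : ℕ, z + k = m := ⟨(z + k).toNat, by lia⟩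
    have hval : (mu + ∑ j, f j • (rootSystem H).root j) ((rootSystem H).coroot i) = (m : ℂ) := by
      have hroot (j : H.root) : (rootSystem H).root j ((rootSystem H).coroot i) =
        ((rootSystem H).pairingIn ℤ j i : ℂ) := ((rootSystem H).algebraMap_pairingIn ℤ j i).symm
      have hm' : (m : ℂ) = ((z + k : ℤ) : ℂ) := by rw [hm, Int.cast_natCast]
      rw [LinearMap.add_apply, hk, LinearMap.sum_apply, hm', add_comm]
      push_cast [z]
      congr 1
      refine Finset.sum_congr rfl fun j _ ↦ ?_
      rw [LinearMap.smul_apply, hroot, nsmul_eq_mul]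
    have hstep := multiplicity_sub_nsmul_ne_zero nu (b.isPos_of_mem_support i.2) hval
      (k := 1) (by lia) hf
    have hsplit (g : b.support → ℕ) :
        ∑ j, (g + Pi.single i 1 : b.support → ℕ) j • (rootSystem H).root j =
        ∑ j, g j • (rootSystem H).root j + (rootSystem H).root i := by
      simp [add_smul, Finset.sum_add_distrib, Pi.single_apply, ite_smul]
    obtain ⟨g, rfl⟩ : ∃ g : b.support → ℕ, f = g + Pi.single i 1 := by
      refine ⟨f - Pi.single i 1, (tsub_add_cancel_of_le fun j ↦ ?_).symm⟩
      rcases eq_or_ne j i with rfl | hj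
      · rw [Pi.single_eq_same]
        exact hfi
      · simp [hj]
    refine ih g ?_ ?_
    · rwa [hsplit, one_smul, ← add_assoc, add_sub_cancel_right] at hstep
    · simpa [Finset.sum_add_distrib] using hs

/-- The set of positive roots on whose coroots a weight takes negative values. -/
def inversions (mu : Dual ℂ H) : Set H.root :=
  {i | b.IsPos i ∧ (mu ((rootSystem H).coroot i)).re < 0}

/-- The simple reflection permutes the positive roots other than `α_i`, so it injects the inversions
of the reflected weight into those of `mu`. It misses `α_i`, an inversion of `mu` whose preimage
`-α_i` is not positive. -/
theorem ncard_inversions_reflection_lt {mu : Dual ℂ H} {i : H.root} (hi : i ∈ b.support)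
    (hmu : (mu ((rootSystem H).coroot i)).re < 0) :
    (inversions b ((rootSystem H).reflection i mu)).ncard < (inversions b mu).ncard := by
  have hinj : Function.Injective ((rootSystem H).reflectionPerm i) := Equiv.injective _
  rw [← Set.ncard_image_of_injective _ hinj]
  have hrefl (j : H.root) : (rootSystem H).reflection i mu ((rootSystem H).coroot j) =
      mu ((rootSystem H).coroot ((rootSystem H).reflectionPerm i j)) :=
    (rootSystem H).coroot'_reflection mu
  have hself : (rootSystem H).reflection i mu ((rootSystem H).coroot i) =
      -mu ((rootSystem H).coroot i) := by
    rw [hrefl, RootPairing.coroot_reflectionPerm, RootPairing.coreflection_apply_self, map_neg]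
  refine Set.ncard_lt_ncard ⟨?_, fun hsub ↦ ?_⟩ (Set.toFinite _)
  · rintro - ⟨j, ⟨hj, hj'⟩, rfl⟩
    have hji : j ≠ i := by
      rintro rfl
      rw [hself, Complex.neg_re] at hj'
      linarith
    exact ⟨hj.reflectionPerm hi hji, by rwa [← hrefl]⟩
  · obtain ⟨j, ⟨hj, -⟩, hji⟩ := hsub ⟨b.isPos_of_mem_support hi, hmu⟩
    have hj' := hj
    rw [RootPairing.Base.isPos_iff] at hj
    obtain rfl : j = (rootSystem H).reflectionPerm i i :=
      hinj (by rw [hji, RootPairing.reflectionPerm_self])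
    exact (RootPairing.Base.IsPos.neg_iff_not b i).mp hj' (b.isPos_of_mem_support hi)

variable [LieAlgebra.IsSimple ℂ L]

theorem exists_forall_multiplicity_ne_zero {lam : Dual ℂ H} (hlam : IsDominantIntegral b lam)
    (hlam0 : lam ≠ 0) (mu : Dual ℂ H) (hmu : mu - lam ∈ rootLattice H) :
    ∃ N : ℕ, ∀ n : ℕ, N ≤ n → n • lam - lam ∈ rootLattice H →
      multiplicity b (n • lam) mu ≠ 0 := by
  induction hs : (inversions b mu).ncard using Nat.strong_induction_on generalizing mu with
  | _ s ih =>
  have hint (i : H.root) (hi : i ∈ b.support) : ∃ z : ℤ, mu ((rootSystem H).coroot i) = z := by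
    obtain ⟨k, hk⟩ := hlam i hi
    obtain ⟨z, hz⟩ := exists_int_apply_coroot_eq hmu i
    refine ⟨z + k, ?_⟩
    rw [LinearMap.sub_apply, hk] at hz
    push_cast
    linear_combination hz
  by_cases hdom : IsDominantIntegral b mu
  -- Simplicity of `L` enters here, through irreducibility of its root system.
  · have hpos := b.re_repr_pos hlam hlam0
    choose N hN using fun i ↦
      exists_nat_ge ((b.toWeightBasis.repr mu i).re / (b.toWeightBasis.repr lam i).re)
    -- The sum serves as a common upper bound: for `n ≥ N i` the `i`-th coordinate of `n • lam - mu`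
    -- is nonnegative.
    refine ⟨∑ i, N i, fun n hn hnQ ↦ ?_⟩
    have hQ : n • lam - mu ∈ rootLattice H := by
      have := sub_mem hnQ hmu
      rwa [sub_sub_sub_cancel_right] at this
    choose z hz using exists_int_repr_eq b hQ
    have hz₀ (i) : 0 ≤ z i := by
      have h₁ := congr_arg Complex.re (hz i)
      rw [map_sub, map_nsmul, Finsupp.sub_apply, Finsupp.smul_apply, Complex.sub_re,
        Complex.re_nsmul, Complex.intCast_re, nsmul_eq_mul] at h₁
      have h₂ : (N i : ℝ) ≤ n := by
        exact_mod_cast (Finset.single_le_sum (fun _ _ ↦ Nat.zero_le _) (Finset.mem_univ i)).trans hn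
      have h₃ := (div_le_iff₀ (hpos i)).mp ((hN i).trans h₂)
      have : (0 : ℝ) ≤ z i := by rw [← h₁]; linarith
      exact_mod_cast this
    refine multiplicity_ne_zero_of_le b hdom (fun i ↦ (z i).toNat) ?_
    have hsum : ∑ i, (z i).toNat • (rootSystem H).root i = n • lam - mu := by
      rw [← b.toWeightBasis.sum_repr (n • lam - mu)]
      refine Finset.sum_congr rfl fun i _ ↦ ?_
      rw [hz, b.toWeightBasis_apply, Int.cast_smul_eq_zsmul, ← natCast_zsmul,
        Int.toNat_of_nonneg (hz₀ i)]
    rw [hsum, add_sub_cancel]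
    exact multiplicity_self_ne_zero b _
  · obtain ⟨i, hi, hneg⟩ : ∃ i ∈ b.support, ∀ k : ℕ, mu ((rootSystem H).coroot i) ≠ k := by
      simpa [IsDominantIntegral] using hdom
    obtain ⟨z, hz⟩ := hint i hi
    obtain ⟨m, rfl⟩ : ∃ m : ℕ, z = -m := by
      refine ⟨(-z).toNat, ?_⟩
      by_contra! h
      refine hneg z.toNat ?_
      rw [hz]
      exact_mod_cast (by lia : z = z.toNat)
    push_cast at hz
    have hm : 0 < m := by
      rw [Nat.pos_iff_ne_zero]
      rintro rfl
      exact hneg 0 (by simpa using hz)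
    have hrefl : (rootSystem H).reflection i mu = mu + m • (rootSystem H).root i := by
      have h : (rootSystem H).coroot' i mu = -(m : ℂ) := hz
      rw [RootPairing.reflection_apply, h, neg_smul, sub_neg_eq_add, Nat.cast_smul_eq_nsmul]
    -- The bound for the reflected weight also serves `mu`: the reflected weight is `mu + m • α_i`
    -- and has value `m` on `α_i^∨`, so its `α_i`-string reaches down to `mu`.
    obtain ⟨N, hN⟩ := ih _ (hs ▸ ncard_inversions_reflection_lt b hi (by
        rw [hz, Complex.neg_re, Complex.natCast_re]
        simpa using hm)) ((rootSystem H).reflection i mu) (by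
        rw [hrefl, add_sub_right_comm]
        exact add_mem hmu (nsmul_mem (AddSubgroup.subset_closure (Set.mem_range_self i)) m)) rfl
    refine ⟨N, fun n hn hnQ ↦ ?_⟩
    have hval : (rootSystem H).reflection i mu ((rootSystem H).coroot i) = m := by
      have h₂ : (rootSystem H).root i ((rootSystem H).coroot i) = 2 :=
        (rootSystem H).root_coroot_two i
      rw [hrefl, LinearMap.add_apply, LinearMap.smul_apply, h₂, hz, nsmul_eq_mul]
      ring
    have := multiplicity_sub_nsmul_ne_zero _ (b.isPos_of_mem_support hi) hval le_rfl (hN n hn hnQ)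
    rwa [hrefl, add_sub_cancel_right] at this

end HighestWeight

theorem mainTheorem7 {L : Type*} [LieRing L] [LieAlgebra ℂ L] [FiniteDimensional ℂ L]
    [LieAlgebra.IsSimple ℂ L]
    (H : LieSubalgebra ℂ L) [H.IsCartanSubalgebra]
    (b : (LieAlgebra.IsKilling.rootSystem H).Base)
    (lam mu : Module.Dual ℂ H)
    (hlam : HighestWeight.IsDominantIntegral b lam) (hlam0 : lam ≠ 0)
    (hmu : mu - lam ∈ HighestWeight.rootLattice H) :
    ∃ N : ℕ, ∀ n : ℕ, N ≤ n → n • lam - lam ∈ HighestWeight.rootLattice H →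
      HighestWeight.multiplicity b (n • lam) mu ≠ 0 :=
  HighestWeight.exists_forall_multiplicity_ne_zero b hlam hlam0 mu hmu
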